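/- Let $N\ge 1$ and let $f:\{0,1\}^N\to\{0,1\}$ be a Boolean function. A *non-adaptive query algorithm with $Q$ queries and $P$ non-collapsing measurements* has $Q$ query registers $|i_j,b_j\rangle$ ($i_j\in\{0,\dots,N-1\}$, $b_j\in\{0,1\}$) and a finite number of workspace qubits. On input $x$ it prepares $U_0|0\rangle$ with a fixed unitary $U_0$, applies once the parallel phase oracle $O_x^{Q}:|i_1,b_1,\dots,i_Q,b_Q\rangle|w\rangle\mapsto(-1)^{\sum_j x(i_j)b_j}|i_1,b_1,\dots,i_Q,b_Q\rangle|w\rangle$, and then, for $t=1,\dots,P$, applies a fixed unitary $U_t$ and a fixed (possibly trivial) collapsing projective measurement $M_t$, after which it receives a sample $v_t$ of a computational-basis measurement of the current state without disturbing that state. Its output is a bit that is a deterministic function of $(v_1,\dots,v_P)$. It *solves $f$ with error $\epsilon$* if for every $x$ the output is $f(x)$ with probability at least $1-\epsilon$. A *valid weight function* for $f$ consists of sets $X\subseteq f^{-1}(0)$, $Y\subseteq f^{-1}(1)$, a nonempty relation $R\subseteq X\times Y$ and weights $w(x,y)=w(y,x)>0$ for $(x,y)\in R$. For $x\in X$ put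 $$wt(x)=\sum_{y:(x,y)\in R}w(x,y),\qquad v(x,i)=\sum_{y:(x,y)\in R,\;x(i)\ne y(i)}w(x,y),$$ and define $wt(y)$, $v(y,i)$ for $y\in Y$ symmetrically; a quotient $wt(z)/v(z,i)$ with $wt(z)>0$ and $v(z,i)=0$ is read as $+\infty$. Put $wt(z)=0$ for all other inputs $z$. Let $0\le\epsilon\le\frac12$ and $C_\epsilon=\sqrt{\frac{1-2\sqrt{\epsilon(1-\epsilon)}}{2}}$. Then every non-adaptive query algorithm with $Q$ queries and $P$ non-collapsing measurements that solves $f$ with error $\epsilon$ satisfies the following. 1. For every valid weight function $w$, $$Q\,P\;\ge\;C_\epsilon^2\,\min_{(x,y)\in R}\;\max\Bigl(\min_i\frac{wt(x)}{v(x,i)},\;\min_i\frac{wt(y)}{v(y,i)}\Bigr).$$ 2. Consequently $$Q\,P\;\ge\;C_\epsilon^2\;\sup_{w}\;\max_{s\in\{0,1\}}\;\min_{\substack{x,i:\;f(x)=s,\\ wt(x)>0}}\frac{wt(x)}{v(x,i)},$$ where $w$ ranges over all valid weight functions for $f$ (a supremum over the empty set being $0$). 3. For all $X\subseteq f^{-1}(0)$,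 $Y\subseteq f^{-1}(1)$ and $R\subseteq X\times Y$, let $m$ (resp. $m'$) be the minimum over $x\in X$ (resp. $y\in Y$) of the number of pairs of $R$ containing $x$ (resp. $y$), and let $l$ (resp. $l'$) be the maximum over $x\in X$ (resp. $y\in Y$) and $i$ of the number of pairs $(x,y)\in R$ containing $x$ (resp. $y$) with $x(i)\ne y(i)$. Then $$Q\,P\;\ge\;C_\epsilon^2\,\max\Bigl\{\frac{m}{l},\frac{m'}{l'}\Bigr\}$$ (for $R=\emptyset$ the right-hand side is read as $0$). In particular, for fixed $\epsilon<\frac12$, $QP=\Omega(\max\{m/l,m'/l'\})$. -/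

import Mathlib

open scoped ENNReal

noncomputable section

namespace NonCollapsing

/-- An input `x = (x(0), …, x(N-1))`, a bit string of length `N`. -/
abbrev Input (N : ℕ) : Type := Fin N → Bool

/-! ### Quantum states, measurements, and non-collapsing samples -/

/-- State space of a quantum system with computational basis `B`. -/
abbrev State (B : Type) [Fintype B] : Type := EuclideanSpace ℂ B

/-- A (collapsing) projective measurement with finitely many outcomes. Measuring any subset of the
qubits in the computational basis, and measuring nothing (one outcome), are special cases. -/
structure Measurement (B : Type) [Fintype B] where
  outcomes : ℕ
  proj : Fin outcomes → (State B →L[ℂ] State B)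
  isStarProjection : ∀ n, IsStarProjection (proj n)
  sum_proj : ∑ n, proj n = 1

/-- One step of a circuit: a unitary gate followed by a collapsing measurement gate. -/
structure Step (B : Type) [Fintype B] where
  unitary : State B ≃ₗᵢ[ℂ] State B
  meas : Measurement B

/-- Rescaling of a nonzero vector to norm one (the zero vector is kept). -/
def normalize {B : Type} [Fintype B] (φ : State B) : State B := ((‖φ‖⁻¹ : ℝ) : ℂ) • φ

/-- The probability that running the steps `c 0, …, c (P-1)` from the unit vector `ψ`, and taking
after each step a non-collapsing computational-basis sample of the current state, yields the
samples `v 0, …, v (P-1)`. The first collapsing measurement has outcome `n` with probability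
`‖φ‖ ^ 2`, where `φ` is the projected vector, and leaves the state `normalize φ`; that state is
sampled (value `v 0`) without being changed, and the computation goes on from it.
Outcomes of probability zero contribute zero. -/
def sampleProb {B : Type} [Fintype B] :
    (P : ℕ) → (Fin P → Step B) → State B → (Fin P → B) → ℝ
  | 0, _, _, _ => 1
  | P + 1, c, ψ, v =>
      ∑ n : Fin (c 0).meas.outcomes,
        let φ : State B := (c 0).meas.proj n ((c 0).unitary ψ)
        ‖φ‖ ^ 2 * (‖normalize φ (v 0)‖ ^ 2 *
          sampleProb P (Fin.tail c) (normalize φ) (Fin.tail v))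

/-! ### The non-adaptive query model -/

/-- Computational basis `|i_1, b_1, …, i_Q, b_Q⟩ |w⟩`: `Q` query registers, each holding an index
and a bit, and `a` workspace qubits. -/
abbrev Basis (N Q a : ℕ) : Type := (Fin Q → Fin N × Bool) × (Fin a → Bool)

/-- The parallel phase oracle
`|i_1, b_1, …, i_Q, b_Q⟩ |w⟩ ↦ (-1) ^ (∑ j, x(i_j) b_j) |i_1, b_1, …, i_Q, b_Q⟩ |w⟩`. -/
def parallelOracle {N Q a : ℕ} (x : Input N) (ψ : State (Basis N Q a)) : State (Basis N Q a) :=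
  WithLp.toLp 2 fun z =>
    (-1 : ℂ) ^ (∑ j : Fin Q, (x (z.1 j).1).toNat * (z.1 j).2.toNat) * ψ z

/-- The all-zero basis state. -/
def zeroState (N Q a : ℕ) [NeZero N] : State (Basis N Q a) :=
  EuclideanSpace.single ((fun _ => (0, false)), (fun _ => false)) 1

/-- A query algorithm with `Q` non-adaptive queries and `P` non-collapsing measurements:
`M_P U_P ⋯ M_1 U_1 O_x^Q U_0 |0⟩` with a non-collapsing measurement after each `M_t U_t`, and a
deterministic classical decision based on the `P` samples. -/
structure Algorithm (N Q P : ℕ) where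
  workspace : ℕ
  initial : State (Basis N Q workspace) ≃ₗᵢ[ℂ] State (Basis N Q workspace)
  steps : Fin P → Step (Basis N Q workspace)
  output : (Fin P → Basis N Q workspace) → Bool

/-- The probability that the algorithm outputs `b` on input `x`. -/
def Algorithm.prob {N Q P : ℕ} [NeZero N] (A : Algorithm N Q P) (x : Input N) (b : Bool) : ℝ :=
  ∑ v : Fin P → Basis N Q A.workspace with A.output v = b,
    sampleProb P A.steps (parallelOracle x (A.initial (zeroState N Q A.workspace))) v

/-- The algorithm computes `f` with error probability at most `ε` on every input. -/
def Algorithm.Solves {N Q P : ℕ} [NeZero N] (A : Algorithm N Q P) (f : Input N → Bool) (ε : ℝ) :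
    Prop :=
  ∀ x, 1 - ε ≤ A.prob x (f x)

/-- `C_ε = √((1 - 2 √(ε (1 - ε))) / 2)`. -/
def C (ε : ℝ) : ℝ := √((1 - 2 * √(ε * (1 - ε))) / 2)

/-! ### Weights -/

/-- A valid weight function for `f`: sets `X ⊆ f⁻¹(0)` and `Y ⊆ f⁻¹(1)`, a relation `R ⊆ X × Y`,
and a weight `w x y > 0` for each `(x, y) ∈ R`. -/
structure WeightFunction {N : ℕ} (f : Input N → Bool) where
  X : Finset (Input N)
  Y : Finset (Input N)
  R : Finset (Input N × Input N)
  w : Input N → Input N → ℝ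
  X_sub : ∀ x ∈ X, f x = false
  Y_sub : ∀ y ∈ Y, f y = true
  R_sub : R ⊆ X ×ˢ Y
  w_pos : ∀ x y, (x, y) ∈ R → 0 < w x y

namespace WeightFunction

variable {N : ℕ} {f : Input N → Bool}

/-- The weight `wt(z)`: the total weight of the pairs of `R` that contain `z`. As `X` and `Y` are
disjoint, at most one of the two sums is nonempty. -/
def wt (S : WeightFunction f) (z : Input N) : ℝ :=
  (∑ y with (z, y) ∈ S.R, S.w z y) + (∑ x with (x, z) ∈ S.R, S.w x z)

/-- The load `v(z, i)`: the total weight of the pairs of `R` that contain `z` and whose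
members differ at position `i`. -/
def v (S : WeightFunction f) (z : Input N) (i : Fin N) : ℝ :=
  (∑ y with (z, y) ∈ S.R ∧ z i ≠ y i, S.w z y) +
    (∑ x with (x, z) ∈ S.R ∧ x i ≠ z i, S.w x z)

/-- `min_i wt(z) / v(z, i)`, where a quotient with `wt(z) > 0` and `v(z, i) = 0` is `∞`. -/
def minRatio (S : WeightFunction f) (z : Input N) : ℝ≥0∞ :=
  ⨅ i : Fin N, ENNReal.ofReal (S.wt z) / ENNReal.ofReal (S.v z i)

end WeightFunction

/-! ### Parameters of the basic adversary method -/

/-- `m`: the least number of pairs `(x, y) ∈ R`, over `x ∈ X`. -/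
def minDegLeft {N : ℕ} (X : Finset (Input N)) (R : Finset (Input N × Input N)) : ℕ :=
  ⨅ x : X, (R.filter fun p => p.1 = (x : Input N)).card

/-- `m'`: the least number of pairs `(x, y) ∈ R`, over `y ∈ Y`. -/
def minDegRight {N : ℕ} (Y : Finset (Input N)) (R : Finset (Input N × Input N)) : ℕ :=
  ⨅ y : Y, (R.filter fun p => p.2 = (y : Input N)).card

/-- `l`: the greatest number of pairs `(x, y) ∈ R` with `x(i) ≠ y(i)`, over `x ∈ X` and `i`. -/
def maxDiffLeft {N : ℕ} (X : Finset (Input N)) (R : Finset (Input N × Input N)) : ℕ :=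
  X.sup fun x => Finset.univ.sup fun i : Fin N =>
    (R.filter fun p => p.1 = x ∧ p.1 i ≠ p.2 i).card

/-- `l'`: the greatest number of pairs `(x, y) ∈ R` with `x(i) ≠ y(i)`, over `y ∈ Y` and `i`. -/
def maxDiffRight {N : ℕ} (Y : Finset (Input N)) (R : Finset (Input N × Input N)) : ℕ :=
  Y.sup fun y => Finset.univ.sup fun i : Fin N =>
    (R.filter fun p => p.2 = y ∧ p.1 i ≠ p.2 i).card

end NonCollapsing

end

namespace NonCollapsing

/-! ### Overlaps under normalization and projective measurement -/

section Vectors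

variable {B : Type} [Fintype B]

/-! Let `k` be the overlap of the states just after the oracle on inputs `x`, `y` with different
values. Each non-collapsing sample costs at most one factor `k` of fidelity between the sample
distributions, so that fidelity is at least `k ^ P` (`norm_inner_pow_le_fidelity`); correctness caps
it at `2√(ε(1-ε))`. Bernoulli's inequality then gives `2 C ε ^ 2 ≤ P (1 - k)`.

Since queries are non-adaptive, the distribution of queried positions is the same for all inputs,
and `1 - k` is at most twice the expected number of queried positions where `x` and `y` differ
(`one_sub_norm_inner_le`). Averaging over the weighted partners of one fixed input bounds each of
the `Q` registers by the maximal load (`Solves.adversary_bound`). This one-sided bound holds at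
every input separately, which is why a maximum of the two ratios is allowed. -/

lemma norm_smul_normalize (φ : State B) : ((‖φ‖ : ℝ) : ℂ) • normalize φ = φ := by
  by_cases h : φ = 0
  · simp [h, normalize]
  · have h' : (‖φ‖ : ℂ) ≠ 0 := by simpa using h
    rw [normalize, smul_smul]
    push_cast
    rw [mul_inv_cancel₀ h', one_smul]

lemma norm_normalize {φ : State B} (h : φ ≠ 0) : ‖normalize φ‖ = 1 := by
  have h' : ‖φ‖ ≠ 0 := by simpa using h
  rw [normalize, norm_smul]
  simp [h']

lemma norm_inner_eq_mul_normalize (φ φ' : State B) :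
    ‖inner ℂ φ φ'‖ = ‖φ‖ * ‖φ'‖ * ‖inner ℂ (normalize φ) (normalize φ')‖ := by
  conv_lhs => rw [← norm_smul_normalize φ, ← norm_smul_normalize φ']
  rw [inner_smul_left, inner_smul_right]
  simp [mul_assoc]

lemma norm_inner_le_sum_coord (φ φ' : State B) :
    ‖inner ℂ φ φ'‖ ≤ ∑ b, ‖φ b‖ * ‖φ' b‖ := by
  rw [PiLp.inner_apply]
  refine (norm_sum_le _ _).trans (Finset.sum_le_sum fun b _ => ?_)
  rw [RCLike.inner_apply, norm_mul]
  simp [mul_comm]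

lemma Measurement.inner_proj (M : Measurement B) (n : Fin M.outcomes) (φ φ' : State B) :
    inner ℂ (M.proj n φ) (M.proj n φ') = inner ℂ φ (M.proj n φ') := by
  have h := M.isStarProjection n
  rw [← ContinuousLinearMap.adjoint_inner_right, ← ContinuousLinearMap.star_eq_adjoint,
    h.isSelfAdjoint.star_eq, ← mul_apply_eq_comp, h.isIdempotentElem.eq]

lemma Measurement.sum_inner_proj (M : Measurement B) (φ φ' : State B) :
    ∑ n, inner ℂ (M.proj n φ) (M.proj n φ') = inner ℂ φ φ' := by
  simp_rw [M.inner_proj]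
  rw [← inner_sum, ← sum_apply, M.sum_proj, one_apply_eq_self]

lemma Measurement.sum_norm_sq_proj (M : Measurement B) (φ : State B) :
    ∑ n, ‖M.proj n φ‖ ^ 2 = ‖φ‖ ^ 2 := by
  have h := M.sum_inner_proj φ φ
  simp_rw [inner_self_eq_norm_sq_to_K] at h
  exact_mod_cast h

lemma Measurement.sum_norm_mul_norm_proj_le (M : Measurement B) {φ φ' : State B}
    (h : ‖φ‖ = 1) (h' : ‖φ'‖ = 1) : ∑ n, ‖M.proj n φ‖ * ‖M.proj n φ'‖ ≤ 1 := by
  have hcs := Finset.sum_mul_sq_le_sq_mul_sq Finset.univ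
    (fun n => ‖M.proj n φ‖) (fun n => ‖M.proj n φ'‖)
  rw [M.sum_norm_sq_proj, M.sum_norm_sq_proj, h, h'] at hcs
  exact le_of_sq_le_sq (by simpa using hcs) zero_le_one

end Vectors

/-- Jensen's inequality for powers with weights of total mass at most one. -/
lemma sum_mul_pow_le_sum_mul_pow {ι : Type*} (s : Finset ι) (q c : ι → ℝ) (P : ℕ)
    (hq : ∀ i ∈ s, 0 ≤ q i) (hc : ∀ i ∈ s, 0 ≤ c i) (hs : ∑ i ∈ s, q i ≤ 1) :
    (∑ i ∈ s, q i * c i) ^ (P + 1) ≤ ∑ i ∈ s, q i * c i ^ (P + 1) := by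
  -- The missing mass sits at `none` with value `0`, harmless because the exponent `P + 1` is
  -- positive.
  have h := Real.pow_arith_mean_le_arith_mean_pow (Finset.insertNone s)
    (fun o => o.elim (1 - ∑ i ∈ s, q i) q) (fun o => o.elim 0 c)
    (by
      rintro (_ | i) hi
      · simpa using hs
      · exact hq i (by simpa using hi))
    (by simp [Finset.sum_insertNone])
    (by
      rintro (_ | i) hi
      · simp
      · exact hc i (by simpa using hi)) (P + 1)
  simpa [Finset.sum_insertNone] using h

/-! ### Sample distributions and their fidelity -/

section Sampling

variable {B : Type} [Fintype B]

lemma sampleProb_nonneg (P : ℕ) (c : Fin P → Step B) (ψ : State B) (v : Fin P → B) :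
    0 ≤ sampleProb P c ψ v := by
  induction P generalizing ψ with
  | zero => simp [sampleProb]
  | succ P ih =>
    rw [sampleProb]
    exact Finset.sum_nonneg fun n _ => mul_nonneg (sq_nonneg _)
      (mul_nonneg (sq_nonneg _) (ih _ _ _))

lemma sum_fin_succ_pi {P : ℕ} (F : (Fin (P + 1) → B) → ℝ) :
    ∑ v, F v = ∑ b, ∑ u : Fin P → B, F (Fin.cons b u) := by
  rw [← Fintype.sum_prod_type', ← (Fin.consEquiv fun _ : Fin (P + 1) => B).sum_comp]
  rfl

lemma sum_sampleProb (P : ℕ) (c : Fin P → Step B) {ψ : State B} (hψ : ‖ψ‖ = 1) :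
    ∑ v, sampleProb P c ψ v = 1 := by
  induction P generalizing ψ with
  | zero => simp [sampleProb]
  | succ P ih =>
    rw [sum_fin_succ_pi]
    simp only [sampleProb, Fin.cons_zero, Fin.tail_cons]
    simp_rw [Finset.sum_comm (s := (Finset.univ : Finset (Fin P → B)))]
    rw [Finset.sum_comm]
    have hn := (c 0).meas.sum_norm_sq_proj ((c 0).unitary ψ)
    rw [LinearIsometryEquiv.norm_map, hψ, one_pow] at hn
    rw [← hn]
    refine Finset.sum_congr rfl fun n _ => ?_
    simp_rw [← Finset.mul_sum]
    by_cases h : (c 0).meas.proj n ((c 0).unitary ψ) = 0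
    · simp [h]
    · rw [ih _ (norm_normalize h)]
      simp_rw [mul_one]
      rw [← EuclideanSpace.norm_sq_eq, norm_normalize h]
      simp

/-- The fidelity of the sample distributions is at least the `P`-th power of the overlap of the
initial states. -/
lemma norm_inner_pow_le_fidelity (P : ℕ) (c : Fin P → Step B) {ψ ψ' : State B}
    (hψ : ‖ψ‖ = 1) (hψ' : ‖ψ'‖ = 1) :
    ‖inner ℂ ψ ψ'‖ ^ P ≤ ∑ v, √(sampleProb P c ψ v) * √(sampleProb P c ψ' v) := by
  induction P generalizing ψ ψ' with
  | zero => simp [sampleProb]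
  | succ P ih =>
    set M := (c 0).meas
    set φ : Fin M.outcomes → State B := fun n => M.proj n ((c 0).unitary ψ) with hφ
    set φ' : Fin M.outcomes → State B := fun n => M.proj n ((c 0).unitary ψ') with hφ'
    set q : Fin M.outcomes → ℝ := fun n => ‖φ n‖ * ‖φ' n‖
    set k : Fin M.outcomes → ℝ := fun n => ‖inner ℂ (normalize (φ n)) (normalize (φ' n))‖
    have hoverlap : ‖inner ℂ ψ ψ'‖ ≤ ∑ n, q n * k n := by
      rw [← (c 0).unitary.inner_map_map, ← M.sum_inner_proj]
      refine (norm_sum_le _ _).trans (Finset.sum_le_sum fun n _ => ?_)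
      exact (norm_inner_eq_mul_normalize _ _).le
    have hq : ∑ n, q n ≤ 1 := M.sum_norm_mul_norm_proj_le (by simpa) (by simpa)
    have hbranch : ∀ n, q n * k n ^ (P + 1) ≤ ∑ b, ∑ u : Fin P → B,
        √(‖φ n‖ ^ 2 * (‖normalize (φ n) b‖ ^ 2 *
            sampleProb P (Fin.tail c) (normalize (φ n)) u)) *
          √(‖φ' n‖ ^ 2 * (‖normalize (φ' n) b‖ ^ 2 *
            sampleProb P (Fin.tail c) (normalize (φ' n)) u)) := by
      intro n
      by_cases h : φ n = 0
      · simp [q, h]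
      by_cases h' : φ' n = 0
      · simp [q, h']
      have hih := ih (Fin.tail c) (norm_normalize h) (norm_normalize h')
      have hk := norm_inner_le_sum_coord (normalize (φ n)) (normalize (φ' n))
      have hk0 : 0 ≤ k n := norm_nonneg _
      -- One factor `k n` pays for the current sample; as sampling leaves the state intact, the
      -- other `P` go to the induction hypothesis.
      calc q n * k n ^ (P + 1) = q n * (k n * k n ^ P) := by rw [pow_succ']
        _ ≤ q n * ((∑ b, ‖normalize (φ n) b‖ * ‖normalize (φ' n) b‖) *
              ∑ u, √(sampleProb P (Fin.tail c) (normalize (φ n)) u) *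
                √(sampleProb P (Fin.tail c) (normalize (φ' n)) u)) :=
            mul_le_mul_of_nonneg_left
              (mul_le_mul hk hih (pow_nonneg hk0 _) (hk0.trans hk))
              (mul_nonneg (norm_nonneg _) (norm_nonneg _))
        _ = _ := by
            rw [Finset.sum_mul_sum, Finset.mul_sum]
            refine Finset.sum_congr rfl fun b _ => ?_
            rw [Finset.mul_sum]
            refine Finset.sum_congr rfl fun u _ => ?_
            simp only [Real.sqrt_mul (sq_nonneg _), Real.sqrt_sq (norm_nonneg _), q]
            ring
    calc ‖inner ℂ ψ ψ'‖ ^ (P + 1) ≤ (∑ n, q n * k n) ^ (P + 1) :=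
          pow_le_pow_left₀ (norm_nonneg _) hoverlap _
      _ ≤ ∑ n, q n * k n ^ (P + 1) :=
          sum_mul_pow_le_sum_mul_pow _ _ _ _
            (fun _ _ => mul_nonneg (norm_nonneg _) (norm_nonneg _))
            (fun _ _ => norm_nonneg _) hq
      _ ≤ _ := Finset.sum_le_sum fun n _ => hbranch n
      _ ≤ _ := by
          rw [sum_fin_succ_pi, Finset.sum_comm]
          refine Finset.sum_le_sum fun b _ => ?_
          rw [Finset.sum_comm]
          refine Finset.sum_le_sum fun u _ => ?_
          simp only [sampleProb, Fin.cons_zero, Fin.tail_cons]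
          -- Cauchy–Schwarz over `n`: forgetting the collapsing outcome cannot lower fidelity.
          exact Real.sum_sqrt_mul_sqrt_le _
            (fun n => mul_nonneg (sq_nonneg _)
              (mul_nonneg (sq_nonneg _) (sampleProb_nonneg _ _ _ _)))
            (fun n => mul_nonneg (sq_nonneg _)
              (mul_nonneg (sq_nonneg _) (sampleProb_nonneg _ _ _ _)))

end Sampling

/-- For unit vectors `(√a, √(1-a))` and `(√b, √(1-b))`, the squares of inner product and determinant
add up to `1`, and the determinant is at least `1 - 2ε`. -/
lemma sqrt_mul_add_sqrt_mul_le {a b ε : ℝ} (ha : 1 - ε ≤ a) (ha' : a ≤ 1) (hb : 0 ≤ b)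
    (hb' : b ≤ ε) (hε : ε ≤ 1 / 2) :
    √a * √b + √(1 - a) * √(1 - b) ≤ 2 * √(ε * (1 - ε)) := by
  have hD : 1 - 2 * ε ≤ √a * √(1 - b) - √(1 - a) * √b := by
    have h₁ : 1 - ε ≤ √a * √(1 - b) := by
      rw [← Real.sqrt_mul (by linarith)]
      apply Real.le_sqrt_of_sq_le
      rw [sq]
      exact mul_le_mul ha (by linarith) (by linarith) (by linarith)
    have h₂ : √(1 - a) * √b ≤ ε := by
      rw [← Real.sqrt_mul (by linarith)]
      refine Real.sqrt_le_iff.2 ⟨by linarith, ?_⟩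
      rw [sq]
      exact mul_le_mul (by linarith) hb' hb (by linarith)
    linarith
  have hpyth : (√a * √b + √(1 - a) * √(1 - b)) ^ 2 +
      (√a * √(1 - b) - √(1 - a) * √b) ^ 2 = 1 := by
    calc _ = (√a ^ 2 + √(1 - a) ^ 2) * (√b ^ 2 + √(1 - b) ^ 2) := by ring
      _ = 1 := by
        rw [Real.sq_sqrt (by linarith), Real.sq_sqrt (by linarith), Real.sq_sqrt hb,
          Real.sq_sqrt (by linarith)]
        ring
  have hD2 := pow_le_pow_left₀ (by linarith) hD 2
  refine le_of_sq_le_sq ?_ (by positivity)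
  rw [mul_pow, Real.sq_sqrt (mul_nonneg (by linarith) (by linarith))]
  nlinarith

lemma C_sq (ε : ℝ) : 2 * C ε ^ 2 = 1 - 2 * √(ε * (1 - ε)) := by
  have h : √(ε * (1 - ε)) ≤ 1 / 2 :=
    Real.sqrt_le_iff.2 ⟨by norm_num, by nlinarith [sq_nonneg (ε - 1 / 2)]⟩
  rw [C, Real.sq_sqrt (by linarith)]
  ring

/-! ### Oracle phases -/

section Oracle

variable {N Q : ℕ}

lemma norm_parallelOracle {a : ℕ} (x : Input N) (ψ : State (Basis N Q a)) :
    ‖parallelOracle x ψ‖ = ‖ψ‖ := by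
  simp [EuclideanSpace.norm_eq, parallelOracle]

/-- The number of queried positions at which `x` and `y` differ. -/
def queryDiff {a : ℕ} (x y : Input N) (z : Basis N Q a) : ℕ :=
  (Finset.univ.filter fun j : Fin Q => x (z.1 j).1 ≠ y (z.1 j).1).card

lemma one_sub_neg_one_pow_mul_le {a : ℕ} (x y : Input N) (z : Basis N Q a) :
    1 - (-1 : ℝ) ^ (∑ j : Fin Q, (x (z.1 j).1).toNat * (z.1 j).2.toNat) *
      (-1 : ℝ) ^ (∑ j : Fin Q, (y (z.1 j).1).toNat * (z.1 j).2.toNat) ≤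
    2 * queryDiff x y z := by
  by_cases h : queryDiff x y z = 0
  · have heq : ∀ j, x (z.1 j).1 = y (z.1 j).1 := by
      simpa [queryDiff, Finset.filter_eq_empty_iff] using h
    simp [heq, h, ← mul_pow]
  · have h1 : (1 : ℝ) ≤ queryDiff x y z := by exact_mod_cast Nat.one_le_iff_ne_zero.2 h
    rw [← pow_add]
    rcases neg_one_pow_eq_or ℝ (∑ j : Fin Q, (x (z.1 j).1).toNat * (z.1 j).2.toNat +
      ∑ j : Fin Q, (y (z.1 j).1).toNat * (z.1 j).2.toNat) with h' | h' <;> rw [h'] <;> linarith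

end Oracle

/-! ### From correctness to the one-sided bound -/

namespace Algorithm

variable {N Q P : ℕ} [NeZero N] (A : Algorithm N Q P)

/-- The state of the algorithm before the oracle is applied. -/
noncomputable def initialState : State (Basis N Q A.workspace) :=
  A.initial (zeroState N Q A.workspace)

lemma sum_norm_sq_initialState : ∑ z, ‖A.initialState z‖ ^ 2 = 1 := by
  rw [← EuclideanSpace.norm_sq_eq, initialState, LinearIsometryEquiv.norm_map, zeroState]
  simp

lemma norm_parallelOracle_initialState (x : Input N) :
    ‖parallelOracle x A.initialState‖ = 1 := by
  rw [norm_parallelOracle, initialState, LinearIsometryEquiv.norm_map, zeroState]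
  simp

/-- The oracle is diagonal, so the inner product is the mean of a product of signs under a
distribution independent of the input. -/
lemma one_sub_norm_inner_le (x y : Input N) :
    1 - ‖inner ℂ (parallelOracle x A.initialState) (parallelOracle y A.initialState)‖ ≤
      2 * ∑ z, ‖A.initialState z‖ ^ 2 * queryDiff x y z := by
  have hre : (inner ℂ (parallelOracle x A.initialState) (parallelOracle y A.initialState)).re =
      ∑ z, ‖A.initialState z‖ ^ 2 *
        ((-1 : ℝ) ^ (∑ j : Fin Q, (x (z.1 j).1).toNat * (z.1 j).2.toNat) *
          (-1 : ℝ) ^ (∑ j : Fin Q, (y (z.1 j).1).toNat * (z.1 j).2.toNat)) := by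
    rw [PiLp.inner_apply, Complex.re_sum]
    refine Finset.sum_congr rfl fun z => fun _ => ?_
    rw [← Complex.ofReal_re (‖A.initialState z‖ ^ 2 * _)]
    congr 1
    push_cast
    rw [← Complex.conj_mul']
    simp only [parallelOracle, RCLike.inner_apply, map_mul, map_pow, map_neg, map_one]
    ring
  have hle := (le_abs_self _).trans (Complex.abs_re_le_norm
    (inner ℂ (parallelOracle x A.initialState) (parallelOracle y A.initialState)))
  rw [hre] at hle
  calc _ ≤ _ := sub_le_sub_left hle 1
    _ = ∑ z, ‖A.initialState z‖ ^ 2 *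
        (1 - (-1 : ℝ) ^ (∑ j : Fin Q, (x (z.1 j).1).toNat * (z.1 j).2.toNat) *
          (-1 : ℝ) ^ (∑ j : Fin Q, (y (z.1 j).1).toNat * (z.1 j).2.toNat)) := by
      simp_rw [mul_sub, mul_one, Finset.sum_sub_distrib, A.sum_norm_sq_initialState]
    _ ≤ ∑ z, ‖A.initialState z‖ ^ 2 * (2 * queryDiff x y z) :=
      Finset.sum_le_sum fun z _ =>
        mul_le_mul_of_nonneg_left (one_sub_neg_one_pow_mul_le x y z) (sq_nonneg _)
    _ = _ := by
      rw [Finset.mul_sum]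
      exact Finset.sum_congr rfl fun z _ => by ring

lemma prob_nonneg (x : Input N) (b : Bool) : 0 ≤ A.prob x b :=
  Finset.sum_nonneg fun _ _ => sampleProb_nonneg _ _ _ _

lemma prob_add_prob_not (x : Input N) (b : Bool) : A.prob x b + A.prob x (!b) = 1 := by
  rw [← sum_sampleProb P A.steps (A.norm_parallelOracle_initialState x),
    ← Finset.sum_filter_add_sum_filter_not Finset.univ (fun v => A.output v = b), prob, prob]
  simp only [← Bool.eq_not]
  rfl

/-- Coarse-graining samples to the output bit cannot lower fidelity: Cauchy–Schwarz on each fibre of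
`A.output`. -/
lemma fidelity_le (x y : Input N) (b : Bool) :
    ∑ v, √(sampleProb P A.steps (parallelOracle x A.initialState) v) *
        √(sampleProb P A.steps (parallelOracle y A.initialState) v) ≤
      √(A.prob x b) * √(A.prob y b) + √(A.prob x (!b)) * √(A.prob y (!b)) := by
  rw [← Finset.sum_filter_add_sum_filter_not Finset.univ (fun v => A.output v = b)]
  simp only [← Bool.eq_not]
  exact add_le_add
    (Real.sum_sqrt_mul_sqrt_le _ (fun _ => sampleProb_nonneg _ _ _ _)
      fun _ => sampleProb_nonneg _ _ _ _)
    (Real.sum_sqrt_mul_sqrt_le _ (fun _ => sampleProb_nonneg _ _ _ _)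
      fun _ => sampleProb_nonneg _ _ _ _)

variable {A} {f : Input N → Bool} {ε : ℝ}

/-- Inputs with different values are queried at a differing position with large probability. -/
lemma Solves.C_sq_le (hA : A.Solves f ε) (hε₁ : ε ≤ 1 / 2) {x y : Input N}
    (hxy : f x ≠ f y) :
    C ε ^ 2 ≤ P * ∑ z, ‖A.initialState z‖ ^ 2 * queryDiff x y z := by
  set k := ‖inner ℂ (parallelOracle x A.initialState) (parallelOracle y A.initialState)‖ with hk
  have hy : f y = !f x := Bool.eq_not.2 hxy.symm
  have hpx := hA x
  have hpy := hA y
  rw [hy] at hpy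
  have hsx := A.prob_add_prob_not x (f x)
  have hsy := A.prob_add_prob_not y (f x)
  have hF := (norm_inner_pow_le_fidelity P A.steps (A.norm_parallelOracle_initialState x)
    (A.norm_parallelOracle_initialState y)).trans (A.fidelity_le x y (f x))
  have hsc := sqrt_mul_add_sqrt_mul_le hpx (by linarith [A.prob_nonneg x (!f x)])
    (A.prob_nonneg y (f x)) (by linarith) hε₁
  rw [eq_sub_of_add_eq' hsx, eq_sub_of_add_eq' hsy] at hF
  have hC := C_sq ε
  have hk0 : 0 ≤ k := norm_nonneg _
  have hbern := one_add_mul_le_pow (a := k - 1) (by linarith) P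
  rw [add_sub_cancel] at hbern
  have hlow := mul_le_mul_of_nonneg_left (A.one_sub_norm_inner_le x y) (Nat.cast_nonneg P)
  rw [← hk] at hF hlow
  linarith

/-- The one-sided adversary bound at an input `x`. -/
lemma Solves.adversary_bound (hA : A.Solves f ε) (hε₁ : ε ≤ 1 / 2) (x : Input N)
    (T : Finset (Input N)) (w : Input N → ℝ) {K : ℝ} (hT : ∀ y ∈ T, f x ≠ f y)
    (hw : ∀ y ∈ T, 0 ≤ w y) (hK : ∀ i, ∑ y ∈ T with x i ≠ y i, w y ≤ K) :
    C ε ^ 2 * ∑ y ∈ T, w y ≤ Q * P * K := by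
  -- In a basis state each register holds a single position, so it contributes at most `K`.
  have hload : ∀ z : Basis N Q A.workspace, ∑ y ∈ T, w y * queryDiff x y z ≤ Q * K := by
    intro z
    calc ∑ y ∈ T, w y * queryDiff x y z
        = ∑ y ∈ T, ∑ j : Fin Q, if x (z.1 j).1 ≠ y (z.1 j).1 then w y else 0 := by
          refine Finset.sum_congr rfl fun y _ => ?_
          rw [← Finset.sum_filter, Finset.sum_const, nsmul_eq_mul, mul_comm, queryDiff]
      _ = ∑ j : Fin Q, ∑ y ∈ T with x (z.1 j).1 ≠ y (z.1 j).1, w y := by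
          rw [Finset.sum_comm]
          simp_rw [Finset.sum_filter]
      _ ≤ ∑ _j : Fin Q, K := Finset.sum_le_sum fun j _ => hK _
      _ = Q * K := by simp
  calc C ε ^ 2 * ∑ y ∈ T, w y = ∑ y ∈ T, w y * C ε ^ 2 := by rw [mul_comm, Finset.sum_mul]
    _ ≤ ∑ y ∈ T, w y * (P * ∑ z, ‖A.initialState z‖ ^ 2 * queryDiff x y z) :=
      Finset.sum_le_sum fun y hy =>
        mul_le_mul_of_nonneg_left (hA.C_sq_le hε₁ (hT y hy)) (hw y hy)
    _ = P * ∑ z, ‖A.initialState z‖ ^ 2 * ∑ y ∈ T, w y * queryDiff x y z := by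
      simp_rw [Finset.mul_sum]
      rw [Finset.sum_comm]
      exact Finset.sum_congr rfl fun _ _ => Finset.sum_congr rfl fun _ _ => by ring
    _ ≤ P * ∑ z, ‖A.initialState z‖ ^ 2 * (Q * K) :=
      mul_le_mul_of_nonneg_left (Finset.sum_le_sum fun z _ =>
        mul_le_mul_of_nonneg_left (hload z) (sq_nonneg _)) (Nat.cast_nonneg P)
    _ = Q * P * K := by
      rw [← Finset.sum_mul, A.sum_norm_sq_initialState]
      ring

end Algorithm

/-! ### Weights seen from one input -/

namespace WeightFunction

variable {N : ℕ} {f : Input N → Bool} (S : WeightFunction f)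

lemma value_of_mem {x y : Input N} (h : (x, y) ∈ S.R) : f x = false ∧ f y = true := by
  have := Finset.mem_product.1 (S.R_sub h)
  exact ⟨S.X_sub x this.1, S.Y_sub y this.2⟩

/-- The value `f z` makes one of the two sums in `wt` and `v` empty, so both sides of `R` can be
treated alike. -/
lemma exists_partners (z : Input N) : ∃ (T : Finset (Input N)) (u : Input N → ℝ),
    (∀ y ∈ T, f z ≠ f y) ∧ (∀ y ∈ T, 0 ≤ u y) ∧ S.wt z = ∑ y ∈ T, u y ∧
      ∀ i, S.v z i = ∑ y ∈ T with z i ≠ y i, u y := by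
  cases hz : f z with
  | false =>
    have h : ∀ x, (x, z) ∉ S.R := fun x hx => by simp [(S.value_of_mem hx).2] at hz
    refine ⟨Finset.univ.filter fun y => (z, y) ∈ S.R, S.w z, fun y hy => ?_, fun y hy => ?_, ?_,
      fun i => ?_⟩
    · simp [(S.value_of_mem (Finset.mem_filter.1 hy).2).2]
    · exact (S.w_pos z y (Finset.mem_filter.1 hy).2).le
    · simp [wt, h]
    · simp [v, h, Finset.filter_filter]
  | true =>
    have h : ∀ y, (z, y) ∉ S.R := fun y hy => by simp [(S.value_of_mem hy).1] at hz
    refine ⟨Finset.univ.filter fun x => (x, z) ∈ S.R, fun x => S.w x z, fun y hy => ?_,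
      fun y hy => ?_, ?_, fun i => ?_⟩
    · simp [(S.value_of_mem (Finset.mem_filter.1 hy).2).1]
    · exact (S.w_pos y z (Finset.mem_filter.1 hy).2).le
    · simp [wt, h]
    · simp [v, h, Finset.filter_filter, eq_comm]

lemma wt_pos_of_mem {x y : Input N} (h : (x, y) ∈ S.R) : 0 < S.wt x ∧ 0 < S.wt y := by
  have h₁ : ∀ z, 0 ≤ ∑ y with (z, y) ∈ S.R, S.w z y := fun z =>
    Finset.sum_nonneg fun y hy => (S.w_pos _ _ (Finset.mem_filter.1 hy).2).le
  have h₂ : ∀ z, 0 ≤ ∑ x with (x, z) ∈ S.R, S.w x z := fun z =>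
    Finset.sum_nonneg fun x hx => (S.w_pos _ _ (Finset.mem_filter.1 hx).2).le
  refine ⟨add_pos_of_pos_of_nonneg ?_ (h₂ x), add_pos_of_nonneg_of_pos (h₁ y) ?_⟩
  · exact Finset.sum_pos (fun y hy => S.w_pos _ _ (Finset.mem_filter.1 hy).2) ⟨y, by simpa⟩
  · exact Finset.sum_pos (fun y hy => S.w_pos _ _ (Finset.mem_filter.1 hy).2) ⟨x, by simpa⟩

end WeightFunction

/-! ### Ratio and degree bounds -/

section Bounds

variable {N Q P : ℕ} [NeZero N] {f : Input N → Bool} {ε : ℝ} {A : Algorithm N Q P}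

lemma Algorithm.Solves.minRatio_le (hA : A.Solves f ε) (hε₁ : ε ≤ 1 / 2)
    (S : WeightFunction f) {z : Input N} (hz : 0 < S.wt z) :
    ENNReal.ofReal (C ε ^ 2) * S.minRatio z ≤ (Q : ENNReal) * (P : ENNReal) := by
  obtain ⟨T, u, hT, hu, hwt, hv⟩ := S.exists_partners z
  obtain ⟨i, hi⟩ := Finite.exists_max (S.v z)
  have hbound : C ε ^ 2 * S.wt z ≤ Q * P * S.v z i := by
    rw [hwt]
    exact hA.adversary_bound hε₁ z T u hT hu fun j => hv j ▸ hi j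
  have hvi : 0 ≤ S.v z i := by
    rw [hv]
    exact Finset.sum_nonneg fun y hy => hu y (Finset.mem_filter.1 hy).1
  refine (mul_le_mul_right (iInf_le _ i) _).trans ?_
  -- If the maximal load is `0` the ratio is `∞`, but then `hbound` forces `C ε = 0`, and `0 * ∞ =
  -- 0`.
  rcases hvi.eq_or_lt with h0 | hpos
  · have hC : C ε ^ 2 ≤ 0 := by
      by_contra! hC
      rw [← h0, mul_zero] at hbound
      exact absurd hbound (not_le.2 (mul_pos hC hz))
    rw [ENNReal.ofReal_of_nonpos hC, zero_mul]
    exact zero_le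
  · rw [← ENNReal.ofReal_div_of_pos hpos, ← ENNReal.ofReal_mul (sq_nonneg _),
      ← ENNReal.ofReal_natCast, ← ENNReal.ofReal_natCast, ← ENNReal.ofReal_mul (Nat.cast_nonneg _)]
    refine ENNReal.ofReal_le_ofReal ?_
    rw [← mul_div_assoc]
    exact (div_le_iff₀ hpos).2 hbound

/-- The one-sided bound at an input `x` with at least `m` partners, at most `l` of which differ from
`x` at any given position. -/
lemma Algorithm.Solves.degree_bound (hA : A.Solves f ε) (hε₁ : ε ≤ 1 / 2)
    (x : Input N) (T : Finset (Input N)) {m l : ℕ} (hT : ∀ y ∈ T, f x ≠ f y) (hm : m ≤ T.card)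
    (hl : ∀ i, (T.filter fun y => x i ≠ y i).card ≤ l) :
    C ε ^ 2 * ((m : ℝ) / l) ≤ Q * P := by
  -- For `l = 0` the real quotient is `0` by convention.
  rcases Nat.eq_zero_or_pos l with rfl | hpos
  · simp only [Nat.cast_zero, div_zero, mul_zero]
    positivity
  have h := hA.adversary_bound hε₁ x T (fun _ => 1) (K := l) hT (fun _ _ => zero_le_one)
    fun i => by simpa using hl i
  rw [← mul_div_assoc, div_le_iff₀ (by exact_mod_cast hpos)]
  refine le_trans (mul_le_mul_of_nonneg_left ?_ (sq_nonneg _)) h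
  simpa using hm

lemma Algorithm.Solves.left_bound (hA : A.Solves f ε) (hε₁ : ε ≤ 1 / 2)
    {X Y : Finset (Input N)} {R : Finset (Input N × Input N)} (hX : ∀ x ∈ X, f x = false)
    (hY : ∀ y ∈ Y, f y = true) (hR : R ⊆ X ×ˢ Y) :
    C ε ^ 2 * ((minDegLeft X R : ℝ) / maxDiffLeft X R) ≤ Q * P := by
  rcases X.eq_empty_or_nonempty with rfl | ⟨x, hx⟩
  · simp only [minDegLeft, Nat.iInf_of_empty, Nat.cast_zero, zero_div, mul_zero]
    positivity
  have hinj : ∀ s : Finset (Input N × Input N), (∀ p ∈ s, p.1 = x) →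
      Set.InjOn Prod.snd (s : Set (Input N × Input N)) := fun s hs p hp q hq h =>
    Prod.ext ((hs p hp).trans (hs q hq).symm) h
  refine hA.degree_bound hε₁ x ((R.filter fun p => p.1 = x).image Prod.snd) ?_ ?_ ?_
  · intro y hy
    obtain ⟨p, hp, rfl⟩ := Finset.mem_image.1 hy
    rw [hX x hx, hY _ (Finset.mem_product.1 (hR (Finset.mem_filter.1 hp).1)).2]
    simp
  · rw [Finset.card_image_of_injOn (hinj _ fun p hp => (Finset.mem_filter.1 hp).2)]
    exact Nat.sInf_le ⟨⟨x, hx⟩, rfl⟩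
  · intro i
    have hsup : (R.filter fun p => p.1 = x ∧ p.1 i ≠ p.2 i).card ≤ maxDiffLeft X R := by
      unfold maxDiffLeft
      refine Finset.le_sup_of_le hx ?_
      exact Finset.le_sup_of_le (Finset.mem_univ i) le_rfl
    refine le_trans ?_ hsup
    rw [Finset.filter_image, Finset.filter_filter]
    refine Finset.card_image_le.trans (Finset.card_le_card fun p hp => ?_)
    simp only [Finset.mem_filter] at hp ⊢
    exact ⟨hp.1, hp.2.1, by rw [hp.2.1]; exact hp.2.2⟩

lemma Algorithm.Solves.right_bound (hA : A.Solves f ε) (hε₁ : ε ≤ 1 / 2)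
    {X Y : Finset (Input N)} {R : Finset (Input N × Input N)} (hX : ∀ x ∈ X, f x = false)
    (hY : ∀ y ∈ Y, f y = true) (hR : R ⊆ X ×ˢ Y) :
    C ε ^ 2 * ((minDegRight Y R : ℝ) / maxDiffRight Y R) ≤ Q * P := by
  rcases Y.eq_empty_or_nonempty with rfl | ⟨y, hy⟩
  · simp only [minDegRight, Nat.iInf_of_empty, Nat.cast_zero, zero_div, mul_zero]
    positivity
  have hinj : ∀ s : Finset (Input N × Input N), (∀ p ∈ s, p.2 = y) →
      Set.InjOn Prod.fst (s : Set (Input N × Input N)) := fun s hs p hp q hq h =>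
    Prod.ext h ((hs p hp).trans (hs q hq).symm)
  refine hA.degree_bound hε₁ y ((R.filter fun p => p.2 = y).image Prod.fst) ?_ ?_ ?_
  · intro x hx
    obtain ⟨p, hp, rfl⟩ := Finset.mem_image.1 hx
    rw [hY y hy, hX _ (Finset.mem_product.1 (hR (Finset.mem_filter.1 hp).1)).1]
    simp
  · rw [Finset.card_image_of_injOn (hinj _ fun p hp => (Finset.mem_filter.1 hp).2)]
    exact Nat.sInf_le ⟨⟨y, hy⟩, rfl⟩
  · intro i
    have hsup : (R.filter fun p => p.2 = y ∧ p.1 i ≠ p.2 i).card ≤ maxDiffRight Y R := by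
      unfold maxDiffRight
      refine Finset.le_sup_of_le hy ?_
      exact Finset.le_sup_of_le (Finset.mem_univ i) le_rfl
    refine le_trans ?_ hsup
    rw [Finset.filter_image, Finset.filter_filter]
    refine Finset.card_image_le.trans (Finset.card_le_card fun p hp => ?_)
    simp only [Finset.mem_filter] at hp ⊢
    exact ⟨hp.1, hp.2.1, by rw [hp.2.1]; exact hp.2.2.symm⟩

end Bounds

end NonCollapsing

theorem mainTheorem3 {N Q P : ℕ} [NeZero N] (f : NonCollapsing.Input N → Bool)
    (ε : ℝ) (hε₀ : 0 ≤ ε) (hε₁ : ε ≤ 1 / 2)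
    (A : NonCollapsing.Algorithm N Q P) (hA : A.Solves f ε) :
    (∀ S : NonCollapsing.WeightFunction f, S.R.Nonempty →
      ENNReal.ofReal (NonCollapsing.C ε ^ 2) *
          (⨅ p ∈ S.R, max (S.minRatio p.1) (S.minRatio p.2)) ≤
        (Q : ENNReal) * (P : ENNReal)) ∧
    ENNReal.ofReal (NonCollapsing.C ε ^ 2) *
        (⨆ (S : NonCollapsing.WeightFunction f) (_ : S.R.Nonempty) (s : Bool),
          ⨅ (x : NonCollapsing.Input N) (_ : f x = s ∧ 0 < S.wt x), S.minRatio x) ≤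
      (Q : ENNReal) * (P : ENNReal) ∧
    (∀ (X Y : Finset (NonCollapsing.Input N))
      (R : Finset (NonCollapsing.Input N × NonCollapsing.Input N)),
      (∀ x ∈ X, f x = false) → (∀ y ∈ Y, f y = true) → R ⊆ X ×ˢ Y →
      NonCollapsing.C ε ^ 2 *
          max ((NonCollapsing.minDegLeft X R : ℝ) / NonCollapsing.maxDiffLeft X R)
            ((NonCollapsing.minDegRight Y R : ℝ) / NonCollapsing.maxDiffRight Y R) ≤
        (Q : ℝ) * (P : ℝ)) := by
  refine ⟨fun S hS => ?_, ?_, fun X Y R hX hY hR => ?_⟩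
  · obtain ⟨p, hp⟩ := hS
    have hpos := S.wt_pos_of_mem hp
    refine (mul_le_mul_right (iInf₂_le p hp) _).trans ?_
    rcases max_choice (S.minRatio p.1) (S.minRatio p.2) with h | h <;> rw [h]
    · exact hA.minRatio_le hε₁ S hpos.1
    · exact hA.minRatio_le hε₁ S hpos.2
  · simp_rw [ENNReal.mul_iSup]
    refine iSup_le fun S => iSup_le fun ⟨p, hp⟩ => iSup_le fun s => ?_
    -- A pair of `R` supplies an admissible input for either `s`; over an empty range the infimum
    -- would be `∞`.
    have hpos := S.wt_pos_of_mem hp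
    have hval := S.value_of_mem hp
    cases s with
    | false =>
      exact (mul_le_mul_right (iInf₂_le p.1 ⟨hval.1, hpos.1⟩) _).trans
        (hA.minRatio_le hε₁ S hpos.1)
    | true =>
      exact (mul_le_mul_right (iInf₂_le p.2 ⟨hval.2, hpos.2⟩) _).trans
        (hA.minRatio_le hε₁ S hpos.2)
  · rw [mul_max_of_nonneg _ _ (sq_nonneg _)]
    exact max_le (hA.left_bound hε₁ hX hY hR) (hA.right_bound hε₁ hX hY hR)
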